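/- For a finite word $v$, its palindromic length $|v|_{\mathrm{pal}}$ is the least number $k$ such that $v$ is a concatenation of $k$ palindromes. A Sturmian word is an infinite word over the alphabet $\{0,1\}$ that has exactly $n+1$ factors of length $n$ for every $n\ge 0$. For an infinite word $u$ let $PL_u(n)$ be the maximum of $|v|_{\mathrm{pal}}$ over all factors $v$ of $u$ of length $n$. Then there is a universal constant $K$, namely $K = 8/\ln 2$, such that for every Sturmian word $u$ and every integer $n\ge 2$ we have $$PL_u(n)\le K\ln n ,$$ that is, every factor of length $n\ge 2$ of every Sturmian word has palindromic length at most $K\ln n$. -/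

import Mathlib

namespace Sturm

/-- The word `u_i u_{i+1} ⋯ u_{i+n-1}` of length `n` read in the infinite word `u` at position `i`. -/
def factorAt {A : Type*} (u : ℕ → A) (i n : ℕ) : List A :=
  (List.range n).map fun k => u (i + k)

/-- The set of factors of length `n` of the infinite word `u`. -/
def factors {A : Type*} (u : ℕ → A) (n : ℕ) : Set (List A) :=
  {v | ∃ i, v = factorAt u i n}

/-- A Sturmian word: an infinite word over a binary alphabet that has, for every `n ≥ 0`,
exactly `n + 1` factors of length `n`. -/
def IsSturmian (u : ℕ → Fin 2) : Prop :=
  ∀ n : ℕ, (factors u n).ncard = n + 1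

/-- `v` is a concatenation of `k` palindromes. -/
def IsPalConcat {A : Type*} (v : List A) (k : ℕ) : Prop :=
  ∃ ps : List (List A), ps.length = k ∧ (∀ p ∈ ps, List.Palindrome p) ∧ ps.flatten = v

/-- The palindromic length of `v`: the least `k` such that `v` is a concatenation of `k`
palindromes. -/
noncomputable def palLength {A : Type*} (v : List A) : ℕ :=
  sInf {k | IsPalConcat v k}

/-- The maximal palindromic length of a factor of length `n` of `u`. -/
noncomputable def PL {A : Type*} (u : ℕ → A) (n : ℕ) : ℕ :=
  sSup (palLength '' factors u n)

/-- Every word is a concatenation of one-letter palindromes. -/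
theorem isPalConcat_length {A : Type*} (v : List A) : IsPalConcat v v.length := by
  refine ⟨v.map fun a => [a], by simp, ?_, ?_⟩
  · intro p hp
    obtain ⟨a, _, rfl⟩ := List.mem_map.1 hp
    exact List.Palindrome.singleton a
  · induction v with
    | nil => rfl
    | cons a v ih => simp only [List.map_cons, List.flatten_cons, ih, List.singleton_append]

/-- The minimum in the definition of `palLength` is attained. -/
theorem isLeast_palLength {A : Type*} (v : List A) :
    IsLeast {k | IsPalConcat v k} (palLength v) :=
  ⟨Nat.sInf_mem ⟨_, isPalConcat_length v⟩, fun _ hk => Nat.sInf_le hk⟩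

/-- The supremum in the definition of `PL` is a maximum. -/
theorem isGreatest_PL {A : Type*} (u : ℕ → A) (n : ℕ) :
    IsGreatest (palLength '' factors u n) (PL u n) := by
  have hb : BddAbove (palLength '' factors u n) := by
    refine ⟨n, ?_⟩
    rintro _ ⟨v, ⟨i, rfl⟩, rfl⟩
    refine ((isLeast_palLength _).2 (isPalConcat_length _)).trans ?_
    simp [factorAt]
  exact ⟨Nat.sSup_mem ⟨_, _, ⟨0, rfl⟩, rfl⟩ hb, fun _ h => le_csSup hb h⟩

end Sturm

/-!
A finite word `v` is called *palindrome-balanced* here if no palindrome `p` has both `apa` and `bpb`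
among the factors of `v`, for two different letters `a` and `b`. The bound holds for all
palindrome-balanced words, and the factors of a Sturmian word are palindrome-balanced.

*Sturmian words* (`IsSturmian.palBalanced`). As the complexity grows by one at each step, there is
exactly one right special factor of each length. If `apa` and `bpb` are factors, then `p` is right
special, and the right special factor that is one letter longer is `ap` or `bp`, say `ap`. So `bp`
is always followed by `b`. Since `p` is a palindrome, `ap` does not occur at any of the `|p| + 2`
positions that start with an occurrence of `bp`. By the pigeonhole principle a factor of length
`|p| + 1` repeats among them, and as no right special factor comes in between, the word is
ultimately periodic from there on, which contradicts the unbounded complexity.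

*Palindrome-balanced words* (`PalBalanced.palLength_le`). One of the two letters, `b`, is isolated,
and the runs of `a` between consecutive letters `b` take two adjacent lengths `m` and `m + 1` only.
Hence `v = aⁱ b φ(w) aʲ` with `φ(c) = aᵐ⁺ᶜ b`, and `w` is palindrome-balanced again
(`PalBalanced.of_blockCode`). If `p` is a palindrome, then so are `b φ(p)` and, for `p` nonempty,
`φ(p) b⁻¹`; letting these two forms alternate along a factorization of `w` into palindromes shows
that `v` needs at most three palindromes more than `w`. Since `w` has less than half the length of
`v`, induction gives the bound `3 log₂ |v| + 3`.
-/

namespace Sturm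

/-! ### Palindromic length -/

theorem palLength_flatten_le {A : Type*} (ps : List (List A)) (h : ∀ p ∈ ps, p.Palindrome) :
    palLength ps.flatten ≤ ps.length :=
  (isLeast_palLength _).2 ⟨ps, rfl, h, rfl⟩

theorem palLength_append_le {A : Type*} (v w : List A) :
    palLength (v ++ w) ≤ palLength v + palLength w := by
  obtain ⟨ps, hps, hp, rfl⟩ := (isLeast_palLength v).1
  obtain ⟨qs, hqs, hq, rfl⟩ := (isLeast_palLength w).1
  rw [← hps, ← hqs, ← List.flatten_append, ← List.length_append]
  refine palLength_flatten_le _ fun p hpq => ?_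
  rcases List.mem_append.1 hpq with h | h
  exacts [hp p h, hq p h]

theorem palLength_le_one {A : Type*} {p : List A} (hp : p.Palindrome) : palLength p ≤ 1 := by
  simpa using palLength_flatten_le [p] (by simpa using hp)

theorem palindrome_replicate {A : Type*} (n : ℕ) (a : A) : (List.replicate n a).Palindrome :=
  List.Palindrome.iff_reverse_eq.2 List.reverse_replicate

/-! ### Coding by blocks -/

/-- The image of the binary word `w` under the morphism `c ↦ aᵐ⁺ᶜ b`. -/
def blockCode {A : Type*} (a b : A) (m : ℕ) (w : List (Fin 2)) : List A :=
  w.flatMap fun c : Fin 2 => List.replicate (m + c) a ++ [b]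

section blockCode

variable {A : Type*} (a b : A) (m : ℕ)

theorem blockCode_cons (c : Fin 2) (w : List (Fin 2)) :
    blockCode a b m (c :: w) = List.replicate (m + c) a ++ b :: blockCode a b m w := by
  simp [blockCode]

theorem blockCode_append (v w : List (Fin 2)) :
    blockCode a b m (v ++ w) = blockCode a b m v ++ blockCode a b m w := by
  simp [blockCode]

/-- Conjugation by `b` turns the reversal of blocks `aʳ b` into blocks `aʳ b`. -/
theorem reverse_blockCode_append (w : List (Fin 2)) :
    (blockCode a b m w).reverse ++ [b] = b :: blockCode a b m w.reverse := by
  induction w with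
  | nil => rfl
  | cons c w ih =>
    rw [blockCode_cons, List.reverse_cons, blockCode_append, ← List.cons_append, ← ih]
    simp [blockCode]

theorem palindrome_cons_blockCode {p : List (Fin 2)} (hp : p.Palindrome) :
    (b :: blockCode a b m p).Palindrome := by
  rw [List.Palindrome.iff_reverse_eq, List.reverse_cons, reverse_blockCode_append, hp.reverse_eq]

theorem exists_palindrome_blockCode_eq {p : List (Fin 2)} (hp : p.Palindrome) (hne : p ≠ []) :
    ∃ q : List A, q.Palindrome ∧ blockCode a b m p = q ++ [b] := by
  obtain ⟨q, hq⟩ : ∃ q, blockCode a b m p = q ++ [b] := by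
    refine ⟨blockCode a b m p.dropLast ++ List.replicate (m + p.getLast hne) a, ?_⟩
    conv_lhs => rw [← List.dropLast_append_getLast hne, blockCode_append]
    simp [blockCode]
  refine ⟨q, ?_, hq⟩
  have h := (palindrome_cons_blockCode a b m hp).reverse_eq
  rw [hq] at h
  rw [List.Palindrome.iff_reverse_eq]
  simpa using h

/-- The palindromes `b φ(p)` and `φ(p) b⁻¹` alternate along the factorization; the two bounds
depend on whether the letter `b` preceding the coded word is still available. -/
theorem palLength_blockCode_flatten_le (ps : List (List (Fin 2)))
    (hps : ∀ p ∈ ps, p.Palindrome) :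
    palLength (b :: blockCode a b m ps.flatten) ≤ ps.length + 1 ∧
      palLength (blockCode a b m ps.flatten) ≤ ps.length + 1 := by
  induction ps with
  | nil =>
    exact ⟨palLength_le_one (List.Palindrome.singleton b), palLength_le_one List.Palindrome.nil⟩
  | cons p ps ih =>
    obtain ⟨h₁, h₂⟩ := ih fun q hq => hps q (List.mem_cons_of_mem _ hq)
    have hp : p.Palindrome := hps p List.mem_cons_self
    rw [List.flatten_cons, blockCode_append, List.length_cons]
    constructor
    · have := palLength_append_le (b :: blockCode a b m p) (blockCode a b m ps.flatten)
      have := palLength_le_one (palindrome_cons_blockCode a b m hp)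
      rw [List.cons_append] at *
      omega
    · rcases eq_or_ne p [] with rfl | hne
      · exact h₂.trans (Nat.le_succ _)
      · obtain ⟨q, hq, hpq⟩ := exists_palindrome_blockCode_eq a b m hp hne
        have := palLength_append_le q (b :: blockCode a b m ps.flatten)
        have := palLength_le_one hq
        rw [hpq, List.append_assoc, List.singleton_append]
        omega

theorem palLength_cons_blockCode_le (w : List (Fin 2)) :
    palLength (b :: blockCode a b m w) ≤ palLength w + 1 := by
  obtain ⟨ps, hps, hp, rfl⟩ := (isLeast_palLength w).1
  rw [← hps]
  exact (palLength_blockCode_flatten_le a b m ps hp).1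

theorem two_mul_length_le_length_blockCode {m : ℕ} (hm : 1 ≤ m) (w : List (Fin 2)) :
    2 * w.length ≤ (blockCode a b m w).length := by
  induction w with
  | nil => simp
  | cons c w ih =>
    rw [blockCode_cons]
    simp only [List.length_cons, List.length_append, List.length_replicate]
    omega

end blockCode

/-! ### Palindrome-balanced words -/

/-- No palindrome `p` has both `apa` and `bpb` among the factors of `v`, for letters `a ≠ b`. Only
palindromes are tested, so this is by definition a weak form of balance. -/
def PalBalanced {A : Type*} (v : List A) : Prop :=
  ∀ p : List A, p.Palindrome → ∀ a b : A, a ≠ b →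
    a :: (p ++ [a]) <:+: v → ¬ b :: (p ++ [b]) <:+: v

theorem PalBalanced.of_isInfix {A : Type*} {v w : List A} (hv : PalBalanced v) (h : w <:+: v) :
    PalBalanced w :=
  fun p hp a b hab ha hb => hv p hp a b hab (ha.trans h) (hb.trans h)

/-- If `0p0` and `1p1` are factors of `w`, then the palindrome `q = aᵐ b φ(p) aᵐ` gives the factors
`bqb` and `aqa` of `b φ(w)`. -/
theorem PalBalanced.of_blockCode {A : Type*} {a b : A} (hab : a ≠ b) {m : ℕ} {w : List (Fin 2)}
    (h : PalBalanced (b :: blockCode a b m w)) : PalBalanced w := by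
  have key : ∀ p : List (Fin 2), p.Palindrome →
      (0 : Fin 2) :: (p ++ [0]) <:+: w → ¬ (1 : Fin 2) :: (p ++ [1]) <:+: w := by
    rintro p hp ⟨s, t, hst⟩ ⟨s', t', hst'⟩
    set q : List A := List.replicate m a ++ (b :: blockCode a b m p) ++ List.replicate m a with hq
    have hqp : q.Palindrome := by
      have := (palindrome_cons_blockCode a b m hp).reverse_eq
      rw [List.Palindrome.iff_reverse_eq, hq, List.reverse_append, List.reverse_append, this,
        List.reverse_replicate, List.append_assoc]
    refine h q hqp a b hab ?_ ?_
    · refine ⟨b :: blockCode a b m s', b :: blockCode a b m t', ?_⟩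
      have hcomm (l : List A) : List.replicate m a ++ a :: l = a :: (List.replicate m a ++ l) := by
        rw [List.append_cons, ← List.replicate_succ', List.replicate_succ, List.cons_append]
      simp [← hst', hq, blockCode, List.replicate_succ, hcomm]
    · -- the letter before the first block `aᵐ b` ends `b φ(s)`, for which the leading `b` is needed
      obtain ⟨r, hr⟩ : ∃ r, b :: blockCode a b m s = r ++ [b] :=
        ⟨(blockCode a b m s.reverse).reverse, by
          rw [reverse_blockCode_append, List.reverse_reverse]⟩
      refine ⟨r, blockCode a b m t, ?_⟩
      have := congrArg (· ++ blockCode a b m (0 :: (p ++ [0]) ++ t)) hr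
      simpa [← hst, hq, blockCode] using this.symm
  intro p hp x y hxy hx hy
  fin_cases x <;> fin_cases y
  · exact hxy rfl
  · exact key p hp hx hy
  · exact key p hp hy hx
  · exact hxy rfl

/-- Cutting a word after each letter `b` other than the first one. -/
theorem exists_runs {A : Type*} {a b : A} (v : List A) (hv : ∀ x ∈ v, x = a ∨ x = b) :
    (∃ i, v = List.replicate i a) ∨
      ∃ (i j : ℕ) (rs : List ℕ), v = List.replicate i a ++
        (b :: rs.flatMap fun r => List.replicate r a ++ [b]) ++ List.replicate j a := by
  induction v with
  | nil => exact .inl ⟨0, rfl⟩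
  | cons x v ih =>
    rcases hv x List.mem_cons_self with rfl | rfl <;>
      rcases ih fun y hy => hv y (List.mem_cons_of_mem _ hy) with ⟨i, rfl⟩ | ⟨i, j, rs, rfl⟩
    · exact .inl ⟨i + 1, rfl⟩
    · exact .inr ⟨i + 1, j, rs, by simp [List.replicate_succ]⟩
    · exact .inr ⟨0, i, [], by simp⟩
    · exact .inr ⟨0, j, i :: rs, by simp⟩

/-- Each run of `a` between two letters `b` gives a factor `b aʳ b` of the word. -/
theorem isInfix_cons_flatMap_of_mem {A : Type*} (a b : A) {rs : List ℕ} {r : ℕ} (hr : r ∈ rs) :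
    b :: (List.replicate r a ++ [b]) <:+:
      b :: rs.flatMap fun r => List.replicate r a ++ [b] := by
  induction rs with
  | nil => simp at hr
  | cons s rs ih =>
    rcases List.mem_cons.1 hr with rfl | hr
    · exact ⟨[], rs.flatMap fun r => List.replicate r a ++ [b], by simp⟩
    · exact (ih hr).trans ⟨b :: List.replicate s a, [], by simp⟩

/-- A palindrome-balanced word in which `b` is isolated has runs of `a` of two adjacent lengths
only, so that it is the code of a binary word. -/
theorem PalBalanced.exists_blockCode {A : Type*} {a b : A} (hab : a ≠ b) {rs : List ℕ}
    (h : PalBalanced (b :: rs.flatMap fun r => List.replicate r a ++ [b]))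
    (hbb : ¬ [b, b] <:+: b :: rs.flatMap fun r => List.replicate r a ++ [b]) :
    ∃ (m : ℕ) (w : List (Fin 2)), 1 ≤ m ∧
      rs.flatMap (fun r => List.replicate r a ++ [b]) = blockCode a b m w := by
  rcases eq_or_ne rs [] with rfl | hne
  · exact ⟨1, [], le_rfl, rfl⟩
  obtain ⟨m, hm, hmin⟩ : ∃ m ∈ rs, ∀ r ∈ rs, m ≤ r := by
    obtain ⟨m, hm, hmin⟩ := rs.toFinset.exists_min_image id
      (by simpa [Finset.nonempty_iff_ne_empty] using hne)
    exact ⟨m, by simpa using hm, fun r hr => hmin r (by simpa using hr)⟩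
  refine ⟨m, rs.map fun r => if r = m then 0 else 1, ?_, ?_⟩
  · by_contra hm0
    obtain rfl : m = 0 := by omega
    exact hbb (by simpa using isInfix_cons_flatMap_of_mem a b hm)
  · rw [blockCode, List.flatMap_map]
    refine List.flatMap_congr fun r hr => ?_
    have h₁ := hmin r hr
    have h₂ : r ≤ m + 1 := by
      by_contra hlt
      -- the run `aʳ` contains `a aᵐ a`, while `b aᵐ b` is a factor
      refine h _ (palindrome_replicate m a) a b hab (List.IsInfix.trans ?_
        (isInfix_cons_flatMap_of_mem a b hr)) (isInfix_cons_flatMap_of_mem a b hm)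
      refine ⟨[b], List.replicate (r - (m + 2)) a ++ [b], ?_⟩
      have : r = m + 1 + 1 + (r - (m + 2)) := by omega
      conv_rhs => rw [this, List.replicate_add, List.replicate_succ, List.replicate_succ']
      simp
    split_ifs with hrm
    · simp [hrm]
    · obtain rfl : r = m + 1 := by omega
      rfl

/-- A palindrome-balanced binary word has palindromic length at most `3 log₂ |v| + 3`. -/
theorem PalBalanced.palLength_le (v : List (Fin 2)) (hv : PalBalanced v) :
    palLength v ≤ 3 * Nat.log 2 v.length + 3 := by
  induction hn : v.length using Nat.strong_induction_on generalizing v with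
  | _ n ih =>
    obtain ⟨a, b, hab, hletters, hbb⟩ : ∃ a b : Fin 2, a ≠ b ∧ (∀ x, x = a ∨ x = b) ∧
        ¬ [b, b] <:+: v := by
      by_cases h : [0, 0] <:+: v
      · exact ⟨0, 1, by decide, by decide, hv [] .nil 0 1 (by decide) h⟩
      · exact ⟨1, 0, by decide, by decide, h⟩
    rcases exists_runs (a := a) (b := b) v fun x _ => hletters x with ⟨i, hi⟩ | ⟨i, j, rs, hrs⟩
    · rw [hi]
      exact (palLength_le_one (palindrome_replicate i a)).trans (by omega)
    · have hcore : (b :: rs.flatMap fun r => List.replicate r a ++ [b]) <:+: v :=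
        ⟨_, _, hrs.symm⟩
      have hbal := hv.of_isInfix hcore
      obtain ⟨m, w, hm, hw⟩ := hbal.exists_blockCode hab fun h => hbb (h.trans hcore)
      rw [hw] at hrs hbal
      have hlen : 2 * w.length < n := by
        have := two_mul_length_le_length_blockCode a b hm w
        rw [← hn, hrs]
        simp only [List.length_append, List.length_cons]
        omega
      have hstep : palLength v ≤ palLength w + 3 := by
        have h₁ := palLength_append_le
          (List.replicate i a ++ (b :: blockCode a b m w)) (List.replicate j a)
        have h₂ := palLength_append_le (List.replicate i a) (b :: blockCode a b m w)
        have h₃ := palLength_le_one (palindrome_replicate i a)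
        have h₄ := palLength_le_one (palindrome_replicate j a)
        have h₅ := palLength_cons_blockCode_le a b m w
        rw [hrs]
        omega
      rcases Nat.eq_zero_or_pos w.length with h0 | hpos
      · rw [List.length_eq_zero_iff.1 h0] at hstep
        have : palLength ([] : List (Fin 2)) ≤ 0 := palLength_flatten_le [] (by simp)
        omega
      · have h₁ := ih w.length (by omega) w (hbal.of_blockCode hab) rfl
        have h₂ : Nat.log 2 w.length + 1 ≤ Nat.log 2 n := by
          rw [← Nat.log_mul_base one_lt_two hpos.ne']
          exact Nat.log_mono_right (by omega)
        omega

/-! ### Factors of infinite words -/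

section factors

variable {A : Type*} (u : ℕ → A)

@[simp]
theorem length_factorAt (i n : ℕ) : (factorAt u i n).length = n := by
  simp [factorAt]

theorem factorAt_mem_factors (i n : ℕ) : factorAt u i n ∈ factors u n :=
  ⟨i, rfl⟩

theorem factorAt_succ (i n : ℕ) : factorAt u i (n + 1) = factorAt u i n ++ [u (i + n)] := by
  simp [factorAt, List.range_succ]

theorem factorAt_add (i m n : ℕ) :
    factorAt u i (m + n) = factorAt u i m ++ factorAt u (i + m) n := by
  simp [factorAt, List.range_add, Function.comp_def, add_assoc]

theorem factorAt_succ' (i n : ℕ) : factorAt u i (n + 1) = u i :: factorAt u (i + 1) n := by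
  rw [add_comm n 1, factorAt_add]
  simp [factorAt]

theorem getElem?_factorAt {i n k : ℕ} (hk : k < n) : (factorAt u i n)[k]? = some (u (i + k)) := by
  simp [factorAt, hk]

theorem factorAt_congr {i j n : ℕ} (h : ∀ k < n, u (i + k) = u (j + k)) :
    factorAt u i n = factorAt u j n :=
  List.map_congr_left fun k hk => h k (List.mem_range.1 hk)

variable {u}

theorem mem_factors_of_isInfix {w : List A} {i n : ℕ} (h : w <:+: factorAt u i n) :
    w ∈ factors u w.length := by
  obtain ⟨s, t, hst⟩ := h
  have hn : n = s.length + w.length + t.length := by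
    simpa [add_assoc] using (congrArg List.length hst).symm
  rw [hn, factorAt_add, factorAt_add] at hst
  refine ⟨i + s.length, ?_⟩
  have := (List.append_inj hst (by simp)).1
  exact (List.append_inj this (by simp)).2

theorem exists_append_mem_factors {w : List A} {n : ℕ} (hw : w ∈ factors u n) :
    ∃ x, w ++ [x] ∈ factors u (n + 1) := by
  obtain ⟨i, rfl⟩ := hw
  exact ⟨u (i + n), i, (factorAt_succ u i n).symm⟩

theorem mem_factors_of_append {w : List A} {x : A} {n : ℕ} (hw : w ++ [x] ∈ factors u (n + 1)) :
    w ∈ factors u n := by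
  obtain ⟨i, hi⟩ := hw
  rw [factorAt_succ] at hi
  exact ⟨i, (List.append_inj' hi rfl).1⟩

theorem mem_factors_of_cons {w : List A} {x : A} {n : ℕ} (hw : x :: w ∈ factors u (n + 1)) :
    w ∈ factors u n := by
  obtain ⟨i, hi⟩ := hw
  rw [factorAt_succ'] at hi
  exact ⟨i + 1, (List.cons.inj hi).2⟩

/-- The factor `w` of length `n` of `u` is right special: two different letters can follow it. -/
def RightSpecial (u : ℕ → A) (n : ℕ) (w : List A) : Prop :=
  ∃ x y, x ≠ y ∧ w ++ [x] ∈ factors u (n + 1) ∧ w ++ [y] ∈ factors u (n + 1)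

theorem RightSpecial.of_cons {x : A} {w : List A} {n : ℕ} (h : RightSpecial u (n + 1) (x :: w)) :
    RightSpecial u n w :=
  let ⟨y, z, hyz, hy, hz⟩ := h
  ⟨y, z, hyz, mem_factors_of_cons hy, mem_factors_of_cons hz⟩

/-- A repetition at distance `d` with no right special factor in between goes on forever. -/
theorem eq_add_of_forall_not_rightSpecial {n s d : ℕ} (hd : 0 < d)
    (hrep : factorAt u s n = factorAt u (s + d) n)
    (hns : ∀ k < d, ¬ RightSpecial u n (factorAt u (s + k) n)) (k : ℕ) :
    u (s + k + n) = u (s + k + n + d) := by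
  have next : ∀ i j, factorAt u i n = factorAt u j n → ¬ RightSpecial u n (factorAt u i n) →
      u (i + n) = u (j + n) := by
    intro i j hij hnsp
    by_contra hne
    refine hnsp ⟨_, _, hne, ⟨i, (factorAt_succ u i n).symm⟩, ⟨j, ?_⟩⟩
    rw [hij, factorAt_succ]
  have main : ∀ k, factorAt u (s + k) n = factorAt u (s + k + d) n ∧
      ¬ RightSpecial u n (factorAt u (s + k) n) := by
    intro k
    induction k using Nat.strong_induction_on with
    | _ k ih =>
      refine ⟨?_, ?_⟩
      · rcases k with _ | k
        · exact hrep
        · obtain ⟨h₁, h₂⟩ := ih k (Nat.lt_succ_self k)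
          have h₃ : factorAt u (s + k) (n + 1) = factorAt u (s + k + d) (n + 1) := by
            rw [factorAt_succ, factorAt_succ, h₁, next _ _ h₁ h₂]
          rw [factorAt_succ', factorAt_succ'] at h₃
          have h₄ := (List.cons.inj h₃).2
          rwa [add_right_comm (s + k) d 1] at h₄
      · rcases lt_or_ge k d with hk | hk
        · exact hns k hk
        · obtain ⟨h₁, h₂⟩ := ih (k - d) (by omega)
          rw [h₁, show s + (k - d) + d = s + k by omega] at h₂
          exact h₂
  obtain ⟨h₁, h₂⟩ := main k
  rw [next _ _ h₁ h₂, add_right_comm]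

/-- An ultimately periodic word has bounded complexity. -/
theorem ncard_factors_le_of_periodic {s d : ℕ} (hd : 0 < d) (h : ∀ k, u (s + k) = u (s + k + d))
    (n : ℕ) : (factors u n).ncard ≤ s + d := by
  have hmul : ∀ t k, u (s + k) = u (s + k + t * d) := by
    intro t k
    induction t with
    | zero => simp
    | succ t ih =>
      rw [ih, add_assoc s, h, add_mul, one_mul]
      congr 1
      omega
  have hsub : factors u n ⊆ (fun i => factorAt u i n) '' (Finset.range (s + d) : Set ℕ) := by
    rintro _ ⟨i, rfl⟩
    rcases lt_or_ge i (s + d) with hi | hi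
    · exact ⟨i, by simpa using hi, rfl⟩
    · refine ⟨s + (i - s) % d, by simpa using Nat.mod_lt _ hd, factorAt_congr u fun k _ => ?_⟩
      rw [add_assoc, hmul ((i - s) / d)]
      congr 1
      have := Nat.mod_add_div' (i - s) d
      omega
  calc (factors u n).ncard ≤ _ := Set.ncard_le_ncard hsub ((Finset.finite_toSet _).image _)
    _ ≤ (Finset.range (s + d) : Set ℕ).ncard := Set.ncard_image_le (Finset.finite_toSet _)
    _ = s + d := by rw [Set.ncard_coe_finset, Finset.card_range]

end factors

/-! ### Sturmian words -/

section Sturmian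

variable {u : ℕ → Fin 2}

theorem IsSturmian.finite_factors (hu : IsSturmian u) (n : ℕ) : (factors u n).Finite :=
  Set.finite_of_ncard_ne_zero (by rw [hu n]; omega)

theorem IsSturmian.exists_rightSpecial (hu : IsSturmian u) (n : ℕ) :
    ∃ w ∈ factors u n, RightSpecial u n w := by
  by_contra! h
  have hmaps : ∀ v ∈ factors u (n + 1), v.dropLast ∈ factors u n := by
    rintro _ ⟨i, rfl⟩
    rw [factorAt_succ, List.dropLast_concat]
    exact factorAt_mem_factors u i n
  have hinj : Set.InjOn List.dropLast (factors u (n + 1)) := by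
    rintro _ ⟨i, rfl⟩ _ ⟨j, rfl⟩ hij
    rw [factorAt_succ, factorAt_succ, List.dropLast_concat, List.dropLast_concat] at hij
    by_contra hne
    rw [factorAt_succ, factorAt_succ, hij] at hne
    refine h _ (factorAt_mem_factors u j n) ⟨u (i + n), u (j + n), fun h => hne (by rw [h]),
      ⟨i, ?_⟩, ⟨j, ?_⟩⟩
    · rw [factorAt_succ, hij]
    · rw [factorAt_succ]
  have := Set.ncard_le_ncard_of_injOn _ hmaps hinj (hu.finite_factors n)
  rw [hu, hu] at this
  omega

theorem IsSturmian.rightSpecial_unique (hu : IsSturmian u) {n : ℕ} {v w : List (Fin 2)}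
    (hv : RightSpecial u n v) (hw : RightSpecial u n w) : v = w := by
  obtain ⟨x, x', hx, hvx, hvx'⟩ := hv
  obtain ⟨y, y', hy, hwy, hwy'⟩ := hw
  by_contra hne
  have hne' : v ++ [x] ≠ w ++ [y] := fun h => hne (List.append_inj' h rfl).1
  -- two words can be dropped such that every factor of length `n` keeps an extension
  have hsub : factors u n ⊆ List.dropLast '' (factors u (n + 1) \ {v ++ [x], w ++ [y]}) := by
    intro t ht
    rcases eq_or_ne t v with rfl | htv
    · exact ⟨t ++ [x'], ⟨hvx', by simp [hx.symm, hne]⟩, by simp⟩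
    rcases eq_or_ne t w with rfl | htw
    · exact ⟨t ++ [y'], ⟨hwy', by simp [hy.symm, htv]⟩, by simp⟩
    obtain ⟨z, hz⟩ := exists_append_mem_factors ht
    exact ⟨t ++ [z], ⟨hz, by simp [htv, htw]⟩, by simp⟩
  have hfin := (hu.finite_factors (n + 1)).sdiff (t := {v ++ [x], w ++ [y]})
  have h₁ := (Set.ncard_le_ncard hsub (hfin.image _)).trans (Set.ncard_image_le hfin)
  have h₂ := Set.ncard_sdiff_add_ncard_of_subset
    (Set.insert_subset hvx (Set.singleton_subset_iff.2 hwy)) (hu.finite_factors (n + 1))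
  rw [Set.ncard_pair hne', hu] at h₂
  rw [hu] at h₁
  omega

/-- If `bwb` occurs at position `i` and `w` is a palindrome, then `aw` starts at none of the
positions from `i` to `i + |w| + 1`: an overlap would compare a letter `a` of `w` with the letter
`b` at the mirror position. -/
theorem factorAt_ne_of_palindrome {A : Type*} {u : ℕ → A} {w : List A} (hw : w.Palindrome) {a b : A}
    (hab : a ≠ b) {i : ℕ} (hi : b :: (w ++ [b]) = factorAt u i (w.length + 2)) {j : ℕ}
    (hj : j < w.length + 2) : factorAt u (i + j) (w.length + 1) ≠ a :: w := by
  intro h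
  rw [factorAt_succ'] at hi h
  rw [factorAt_succ] at hi
  obtain ⟨hb, hi⟩ := List.cons.inj hi
  obtain ⟨ha, h⟩ := List.cons.inj h
  obtain ⟨hwi, hb'⟩ := List.append_inj' hi rfl
  have hb' : b = u (i + 1 + w.length) := by simpa using hb'
  rcases Nat.eq_zero_or_pos j with rfl | hj0
  · exact hab (by rw [← ha, hb, add_zero])
  rcases eq_or_ne j (w.length + 1) with rfl | hj1
  · exact hab (by rw [← ha, hb', add_right_comm, add_assoc i])
  · -- `w` has the letter `a` at `j - 1` and the letter `b` at the mirror position `|w| - j`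
    have h₁ : w[j - 1]? = some a := by
      rw [hwi, getElem?_factorAt u (by omega), ← ha]
      congr 2
      omega
    have h₂ : w[w.length - j]? = some b := by
      rw [← h, length_factorAt, getElem?_factorAt u (by omega), hb']
      congr 2
      omega
    rw [← hw.reverse_eq, List.getElem?_reverse (by omega),
      show w.length - 1 - (j - 1) = w.length - j by omega, h₂] at h₁
    exact hab (Option.some.inj h₁).symm

theorem IsSturmian.false_of_rightSpecial_cons (hu : IsSturmian u) {w : List (Fin 2)}
    (hw : w.Palindrome) {a b : Fin 2} (hab : a ≠ b)
    (ha : RightSpecial u (w.length + 1) (a :: w))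
    (hb : b :: (w ++ [b]) ∈ factors u (w.length + 2)) : False := by
  obtain ⟨i, hi⟩ := hb
  have hne : ∀ j < w.length + 2, factorAt u (i + j) (w.length + 1) ≠ a :: w :=
    fun j hj => factorAt_ne_of_palindrome hw hab hi hj
  have hmem : a :: w ∈ factors u (w.length + 1) := by
    obtain ⟨x, -, -, hx, -⟩ := ha
    exact mem_factors_of_append hx
  have hfin := (hu.finite_factors (w.length + 1)).sdiff (t := {a :: w})
  obtain ⟨j, hj, k, hk, hjk, heq⟩ := Finset.exists_ne_map_eq_of_card_lt_of_maps_to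
    (s := Finset.range (w.length + 2)) (t := hfin.toFinset)
    (f := fun j => factorAt u (i + j) (w.length + 1))
    (by
      rw [← Set.ncard_eq_toFinset_card _ hfin, Finset.card_range]
      have := Set.ncard_sdiff_singleton_add_one hmem (hu.finite_factors _)
      rw [hu] at this
      omega)
    (fun j hj => by
      rw [Finset.mem_coe, Finset.mem_range] at hj
      rw [Finset.mem_coe, Set.Finite.mem_toFinset]
      exact ⟨factorAt_mem_factors u _ _, hne j hj⟩)
  rw [Finset.mem_range] at hj hk
  wlog hlt : j < k generalizing j k
  · exact this k hk j hj hjk.symm heq.symm (by omega)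
  obtain ⟨d, rfl⟩ := Nat.exists_eq_add_of_lt hlt
  have hper := eq_add_of_forall_not_rightSpecial (u := u) (s := i + j) (d := d + 1) (n := w.length + 1)
    (Nat.succ_pos d) (by rw [heq, add_assoc i, add_assoc j]) fun k hk hsp => by
      refine hne (j + k) (by omega) ?_
      rw [← add_assoc]
      exact hu.rightSpecial_unique hsp ha
  have hcard := ncard_factors_le_of_periodic (u := u) (s := i + j + (w.length + 1)) (d := d + 1)
    (Nat.succ_pos d) (fun k => by
      have := hper k
      rwa [add_right_comm (i + j) k] at this) (i + j + (w.length + 1) + (d + 1))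
  rw [hu] at hcard
  omega

theorem IsSturmian.palBalanced (hu : IsSturmian u) (i n : ℕ) : PalBalanced (factorAt u i n) := by
  intro p hp a b hab ha hb
  have ha' : a :: (p ++ [a]) ∈ factors u (p.length + 2) := by
    simpa using mem_factors_of_isInfix ha
  have hb' : b :: (p ++ [b]) ∈ factors u (p.length + 2) := by
    simpa using mem_factors_of_isInfix hb
  have hsp : RightSpecial u p.length p :=
    ⟨a, b, hab, mem_factors_of_cons ha', mem_factors_of_cons hb'⟩
  obtain ⟨w, ⟨k, rfl⟩, hw⟩ := hu.exists_rightSpecial (p.length + 1)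
  rw [factorAt_succ'] at hw
  rw [hu.rightSpecial_unique hw.of_cons hsp] at hw
  have hc : u k = a ∨ u k = b := by omega
  rcases hc with hc | hc <;> rw [hc] at hw
  · exact hu.false_of_rightSpecial_cons hp hab hw hb'
  · exact hu.false_of_rightSpecial_cons hp hab.symm hw ha'

end Sturmian

end Sturm

theorem theorem2 :
    ∃ K : ℝ, K = 8 / Real.log 2 ∧
      ∀ u : ℕ → Fin 2, Sturm.IsSturmian u →
        ∀ n : ℕ, 2 ≤ n → (Sturm.PL u n : ℝ) ≤ K * Real.log n := by
  refine ⟨_, rfl, fun u hu n hn => ?_⟩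
  obtain ⟨_, ⟨i, rfl⟩, hPL⟩ := (Sturm.isGreatest_PL u n).1
  have h₁ := (hu.palBalanced i n).palLength_le
  rw [hPL, Sturm.length_factorAt] at h₁
  have h₂ : 1 ≤ Nat.log 2 n := Nat.log_pos one_lt_two hn
  have h₃ : Sturm.PL u n ≤ 8 * Nat.log 2 n := by omega
  calc (Sturm.PL u n : ℝ) ≤ 8 * (Nat.log 2 n : ℝ) := by exact_mod_cast h₃
    _ ≤ 8 * Real.logb 2 n := by gcongr; exact_mod_cast Real.natLog_le_logb n 2
    _ = 8 / Real.log 2 * Real.log n := by rw [Real.logb]; ring
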